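/- Let $h(t)=h_0+h_1t+\cdots+h_st^s\in\mathbb{R}[t]$ be a polynomial of degree $s\le d$ with nonnegative coefficients, put $h_i:=0$ for $i\notin\{0,\dots,s\}$, and assume that (H) $h_0+h_1+\cdots+h_i\ge h_d+h_{d-1}+\cdots+h_{d-i+1}$ for all $i$, and (S) $h_0+h_1+\cdots+h_i\le h_s+h_{s-1}+\cdots+h_{s-i}$ for all $i$. For an integer $r\ge 1$ let $U_r^{d+1}h(t)$ be the unique polynomial such that $$\sum_{n\ge 0}a_{rn}t^n=\frac{U_r^{d+1}h(t)}{(1-t)^{d+1}},\qquad\text{where}\qquad \sum_{n\ge 0}a_nt^n=\frac{h(t)}{(1-t)^{d+1}}.$$ Then for every integer $r\ge\max\{s,d+1-s\}$ the symmetric decomposition of $U_r^{d+1}h(t)$ with respect to degree $d$, that is, the unique pair $(\tilde p,\tilde q)$ of polynomials such that $$U_r^{d+1}h(t)=\tilde p(t)+t\,\tilde q(t),\qquad \tilde p(t)=t^{d}\,\tilde p(1/t),\qquad \tilde q(t)=t^{d-1}\,\tilde q(1/t),$$ exists and is nonnegative and real-rooted: $\tilde p$ and $\tilde q$ have only nonnegative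 coefficients, and all their complex zeros are real (the zero polynomial counts as real-rooted). -/

import Mathlib

open Polynomial

/-- The sequence `a` defined by `∑ a n * t ^ n = h(t) / (1 - t) ^ D`. -/
noncomputable def numeratorSequence (D : ℕ) (h : ℝ[X]) (n : ℕ) : ℝ :=
  PowerSeries.coeff n ((h : PowerSeries ℝ) * (PowerSeries.invOneSubPow ℝ D).val)

theorem mk_subsequence_mul_one_sub (r : ℕ) (hr : 1 ≤ r) (F : PowerSeries ℝ) :
    PowerSeries.mk (fun n => PowerSeries.coeff (r * n) (F * (1 - PowerSeries.X ^ r))) =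
      PowerSeries.mk (fun n => PowerSeries.coeff (r * n) F) * (1 - PowerSeries.X) := by
  ext n
  rw [mul_sub, mul_one, mul_sub, mul_one, PowerSeries.coeff_mk, map_sub, map_sub,
    PowerSeries.coeff_mul_X_pow', PowerSeries.coeff_mk]
  cases n with
  | zero =>
    have h0 : r ≠ 0 := by omega
    simp [h0]
  | succ n =>
    have h1 : r ≤ r * (n + 1) := Nat.le_mul_of_pos_right r (Nat.succ_pos n)
    have h2 : r * (n + 1) - r = r * n := by rw [Nat.mul_succ, Nat.add_sub_cancel]
    rw [if_pos h1, h2, PowerSeries.coeff_succ_mul_X, PowerSeries.coeff_mk]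

theorem mk_subsequence_mul_one_sub_pow (r : ℕ) (hr : 1 ≤ r) (D : ℕ) (F : PowerSeries ℝ) :
    PowerSeries.mk (fun n => PowerSeries.coeff (r * n) (F * (1 - PowerSeries.X ^ r) ^ D)) =
      PowerSeries.mk (fun n => PowerSeries.coeff (r * n) F) * (1 - PowerSeries.X) ^ D := by
  induction D with
  | zero => simp
  | succ D ih => rw [pow_succ, pow_succ, ← mul_assoc, ← mul_assoc,
      mk_subsequence_mul_one_sub r hr, ih]

/-- The generating function of every subsequence `a (r * n)`, `r ≥ 1`, has again the form
`g(t) / (1 - t) ^ D` with a polynomial `g`. -/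
theorem existsUnique_subsequenceNumerator (r : ℕ) (hr : 1 ≤ r) (D : ℕ) (h : ℝ[X]) :
    ∃! g : ℝ[X], PowerSeries.mk (fun n => numeratorSequence D h (r * n)) =
      (g : PowerSeries ℝ) * (PowerSeries.invOneSubPow ℝ D).val := by
  have hinv : (PowerSeries.invOneSubPow ℝ D).val * (1 - PowerSeries.X) ^ D = 1 := by
    rw [← PowerSeries.invOneSubPow_inv_eq_one_sub_pow ℝ D]
    exact (PowerSeries.invOneSubPow ℝ D).val_inv
  have key : ((contract r (h * (∑ i ∈ Finset.range r, X ^ i) ^ D) : ℝ[X]) : PowerSeries ℝ) =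
      PowerSeries.mk (fun n => numeratorSequence D h (r * n)) * (1 - PowerSeries.X) ^ D := by
    have h3 : ((h * (∑ i ∈ Finset.range r, X ^ i) ^ D : ℝ[X]) : PowerSeries ℝ) =
        ((h : PowerSeries ℝ) * (PowerSeries.invOneSubPow ℝ D).val) *
          (1 - PowerSeries.X ^ r) ^ D := by
      have h4 : (1 - PowerSeries.X ^ r : PowerSeries ℝ) =
          (1 - PowerSeries.X) * ((∑ i ∈ Finset.range r, X ^ i : ℝ[X]) : PowerSeries ℝ) := by
        have h5 := congrArg (fun f : ℝ[X] => (f : PowerSeries ℝ))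
          (mul_neg_geom_sum (X : ℝ[X]) r)
        simpa using h5.symm
      rw [h4, mul_pow, mul_assoc, ← mul_assoc _ ((1 - PowerSeries.X) ^ D), hinv, one_mul]
      simp
    have h6 := mk_subsequence_mul_one_sub_pow r hr D
      ((h : PowerSeries ℝ) * (PowerSeries.invOneSubPow ℝ D).val)
    rw [← h3] at h6
    unfold numeratorSequence
    rw [← h6]
    ext n
    rw [Polynomial.coeff_coe, coeff_contract (by omega), PowerSeries.coeff_mk,
      Polynomial.coeff_coe, mul_comm n r]
  refine ⟨contract r (h * (∑ i ∈ Finset.range r, X ^ i) ^ D), ?_, ?_⟩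
  · dsimp only
    rw [key, mul_assoc, mul_comm _ (PowerSeries.invOneSubPow ℝ D).val, hinv, mul_one]
  · intro g hg
    apply Polynomial.coe_injective ℝ
    rw [key, hg, mul_assoc, hinv, mul_one]

/-- The operator `U_r^D`: the unique polynomial `g` with
`∑ a (r * n) * t ^ n = g(t) / (1 - t) ^ D` whenever `∑ a n * t ^ n = h(t) / (1 - t) ^ D`.
It is meant for `r ≥ 1` only (the value at `r = 0` is arbitrary). -/
noncomputable def subsequenceNumerator (r D : ℕ) (h : ℝ[X]) : ℝ[X] :=
  if hr : 1 ≤ r then (existsUnique_subsequenceNumerator r hr D h).choose else 0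

theorem subsequenceNumerator_spec (r : ℕ) (hr : 1 ≤ r) (D : ℕ) (h : ℝ[X]) :
    PowerSeries.mk (fun n => numeratorSequence D h (r * n)) =
      (subsequenceNumerator r D h : PowerSeries ℝ) * (PowerSeries.invOneSubPow ℝ D).val := by
  rw [subsequenceNumerator, dif_pos hr]
  exact (existsUnique_subsequenceNumerator r hr D h).choose_spec.1

/-- `(p, q)` is the symmetric decomposition of `f` with respect to degree `d`:
`f = p + t q` with `p(t) = t ^ d p(1/t)` and `q(t) = t ^ (d - 1) q(1/t)`.
The degree bounds make `t ^ d p(1/t)` and `t ^ (d - 1) q(1/t)` polynomials;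
for `d = 0` they force `q = 0`. -/
structure IsSymmetricDecomposition (d : ℕ) (f p q : ℝ[X]) : Prop where
  eq_add : f = p + X * q
  degree_left : p.degree ≤ d
  reflect_left : p.reflect d = p
  degree_right : q.degree < d
  reflect_right : q.reflect (d - 1) = q

/-!
Multiplication of the numerator by `1 - t` only changes the exponent of the denominator, so
`U_r^{d+1} ((1 - t) a) = (1 - t) U_r^d a`; moreover `U_r (t ^ r a) = t U_r a`. Write
`h - t ^ (d + 1) h(1/t) = (1 - t) a` and `t ^ (d + 1) h(1/t) - t ^ r h = (1 - t) e`. Adding the two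
identities gives `U_r^{d+1} h = U_r^d a + U_r^d e`, and since `a` and `e` are palindromic with
respect to `d` and `d + r`, the summands are the parts `p` and `t q` of the symmetric decomposition.
The coefficients of `a` are nonnegative by (H), those of `e` by (S), and `U_r^d` preserves
nonnegativity, because it keeps every `r`-th coefficient of the product with
`(1 + t + ⋯ + t ^ (r - 1)) ^ d`.

For real-rootedness put `f_j = U_r^d (t ^ j)`, so that `f_{j + r} = t f_j`. Both `a` and `e` have
degree less than `2 r`, so each part has the form `∑_{j < 2r} c_j f_j = u + t v` with
`u = ∑_{j < r} c_j f_j` and `v = ∑_{j < r} c_{j + r} f_j`. At a point `z` of the upper half-plane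
the arguments of the numbers `f_j(z)` increase with `j`, by at most `π` over `r` steps
(`isTurning_veronese`). This goes by induction on `d`: passing from `d` to `d + 1` replaces `f_j` by
`f_j + ⋯ + f_{j + r - 1}` (`IsTurning.window_sum`). The monotonicity of the coefficients of `a` and
`e` near their ends, which uses `r ≥ max s (d + 1 - s)`, gives `c_i c_{j + r} ≤ c_j c_{i + r}` for
`i < j < r`. Hence `Im (conj (v z) * u z) ≥ 0`, and therefore
`Im (conj (v z) * (u z + z * v z)) ≥ Im z * |v z| ^ 2`, so a zero `z` of `u + t v` would be a zero
of both `v` and `u`; for `d ≥ 1` the `f_j(z)` are nonzero and span a cone without lines, so all `c_j` vanish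
(`IsTurning.mul_eq_zero_of_sum_two_windows_eq_zero`). So a nonzero part has no zeros in the upper
half-plane, and being real it has only real zeros. For `d = 0` both parts are constant.
-/

/-! ### Sequences of complex numbers with increasing arguments -/

/-- The area form `a ∧ b = Im (conj a * b)` on `ℂ`, written in coordinates. -/
def wedge (a b : ℂ) : ℝ := a.re * b.im - a.im * b.re

theorem wedge_self (a : ℂ) : wedge a a = 0 := by unfold wedge; ring

theorem wedge_swap (a b : ℂ) : wedge b a = -wedge a b := by unfold wedge; ring

theorem wedge_zero_left (b : ℂ) : wedge 0 b = 0 := by simp [wedge]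

theorem wedge_add_left (a b c : ℂ) : wedge (a + b) c = wedge a c + wedge b c := by
  simp only [wedge, Complex.add_re, Complex.add_im]; ring

theorem wedge_add_right (a b c : ℂ) : wedge a (b + c) = wedge a b + wedge a c := by
  simp only [wedge, Complex.add_re, Complex.add_im]; ring

theorem wedge_ofReal_mul_left (x : ℝ) (a b : ℂ) : wedge (x * a) b = x * wedge a b := by
  simp [wedge]; ring

theorem wedge_ofReal_mul_right (x : ℝ) (a b : ℂ) : wedge a (x * b) = x * wedge a b := by
  simp [wedge]; ring

theorem wedge_self_mul (z a : ℂ) : wedge a (z * a) = z.im * Complex.normSq a := by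
  simp [wedge, Complex.normSq_apply]; ring

theorem wedge_sum_left {ι : Type*} (s : Finset ι) (f : ι → ℂ) (b : ℂ) :
    wedge (∑ i ∈ s, f i) b = ∑ i ∈ s, wedge (f i) b := by
  simp [wedge, Finset.sum_mul, Finset.sum_sub_distrib]

theorem wedge_sum_right {ι : Type*} (s : Finset ι) (a : ℂ) (f : ι → ℂ) :
    wedge a (∑ i ∈ s, f i) = ∑ i ∈ s, wedge a (f i) := by
  simp [wedge, Finset.mul_sum, Finset.sum_sub_distrib]

/-- A sequence `w` of complex numbers with `w (j + r) = z * w j` whose arguments increase by at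
most `π` along every stretch of length at most `r`; zero terms are allowed. When `w j = f j (z)`,
this expresses, at the point `z` of the upper half-plane, that the polynomials `f i, …, f (i + r)`
interlace. -/
structure IsTurning (r : ℕ) (z : ℂ) (w : ℕ → ℂ) : Prop where
  shift : ∀ j, w (j + r) = z * w j
  wedge_nonneg : ∀ i k, k ≤ r → 0 ≤ wedge (w i) (w (i + k))

namespace IsTurning

variable {r : ℕ} {z : ℂ} {w : ℕ → ℂ}

theorem wedge_nonneg' (hw : IsTurning r z w) {i j : ℕ} (hij : i ≤ j) (hj : j ≤ i + r) :
    0 ≤ wedge (w i) (w j) := by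
  have := hw.wedge_nonneg i (j - i) (by omega)
  rwa [Nat.add_sub_cancel' hij] at this

theorem comp_add (hw : IsTurning r z w) (i : ℕ) : IsTurning r z (fun j => w (i + j)) where
  shift j := by rw [← hw.shift, add_assoc]
  wedge_nonneg j k hk := hw.wedge_nonneg' (by omega) (by omega)

/-- Sums over `r` consecutive terms inherit the property: two overlapping windows are
`P + Q` and `Q + z * P`, where every term of `P` precedes every term of `Q`. -/
theorem window_sum (hw : IsTurning r z w) (hz : 0 < z.im) :
    IsTurning r z (fun j => ∑ k ∈ Finset.range r, w (j + k)) where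
  shift j := by
    rw [Finset.mul_sum]
    refine Finset.sum_congr rfl fun k _ => ?_
    rw [← hw.shift, add_right_comm]
  wedge_nonneg i m hm := by
    obtain ⟨n, rfl⟩ := Nat.exists_eq_add_of_le hm
    set P := ∑ k ∈ Finset.range m, w (i + k) with hP
    set Q := ∑ k ∈ Finset.range n, w (i + (m + k)) with hQ
    have h1 : ∑ k ∈ Finset.range (m + n), w (i + k) = P + Q := Finset.sum_range_add _ _ _
    have h2 : z * P = ∑ k ∈ Finset.range m, w (i + k + (m + n)) := by
      rw [hP, Finset.mul_sum]
      exact Finset.sum_congr rfl fun k _ => (hw.shift _).symm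
    have h3 : ∑ k ∈ Finset.range (m + n), w (i + m + k) = Q + z * P := by
      rw [add_comm m n, Finset.sum_range_add, h2, hQ]
      congr 1 <;> refine Finset.sum_congr rfl fun k _ => ?_ <;> congr 1 <;> omega
    have h4 : 0 ≤ wedge P Q := by
      rw [hP, hQ, wedge_sum_left]
      refine Finset.sum_nonneg fun k hk => ?_
      rw [wedge_sum_right]
      refine Finset.sum_nonneg fun k' hk' => ?_
      rw [Finset.mem_range] at hk hk'
      exact hw.wedge_nonneg' (by omega) (by omega)
    have h5 : 0 ≤ wedge Q (z * P) := by
      rw [h2, hQ, wedge_sum_left]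
      refine Finset.sum_nonneg fun k hk => ?_
      rw [wedge_sum_right]
      refine Finset.sum_nonneg fun k' hk' => ?_
      rw [Finset.mem_range] at hk hk'
      exact hw.wedge_nonneg' (by omega) (by omega)
    rw [h1, h3, wedge_add_left, wedge_add_right, wedge_add_right, wedge_self, wedge_self_mul]
    have := mul_nonneg hz.le (Complex.normSq_nonneg P)
    linarith

/-- The terms of a window span a cone without lines: its arguments lie in the half-open interval
from `arg (w k)` to `arg (z * w k)`, where `w k` is its first nonzero term. -/
theorem mul_eq_zero_of_sum_eq_zero (hw : IsTurning r z w) (hz : 0 < z.im) {c : ℕ → ℝ}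
    (hc : ∀ k < r, 0 ≤ c k) (h0 : ∑ k ∈ Finset.range r, (c k : ℂ) * w k = 0) :
    ∀ k < r, (c k : ℂ) * w k = 0 := by
  intro k
  induction k using Nat.strong_induction_on with
  | _ k ih =>
    intro hk
    have h1 : ∑ j ∈ Finset.range r, wedge (c j * w j) (z * w k) = 0 := by
      rw [← wedge_sum_left, h0, wedge_zero_left]
    have h2 : ∀ j ∈ Finset.range r, 0 ≤ wedge (c j * w j) (z * w k) := by
      intro j hj
      rw [Finset.mem_range] at hj
      rcases lt_or_ge j k with hjk | hjk
      · rw [ih j hjk hj, wedge_zero_left]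
      · rw [wedge_ofReal_mul_left, ← hw.shift]
        exact mul_nonneg (hc j hj) (hw.wedge_nonneg' (by omega) (by omega))
    have h3 := (Finset.sum_eq_zero_iff_of_nonneg h2).1 h1 k (Finset.mem_range.2 hk)
    rw [wedge_ofReal_mul_left, wedge_self_mul] at h3
    simpa [hz.ne'] using h3

theorem window_sum_ne_zero (hw : IsTurning r z w) (hz : 0 < z.im) (hr : 1 ≤ r) (h0 : w 0 ≠ 0)
    (i : ℕ) : ∑ k ∈ Finset.range r, w (i + k) ≠ 0 := by
  intro h
  have h1 : ∀ k < r, w (i + k) = 0 := by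
    simpa using (hw.comp_add i).mul_eq_zero_of_sum_eq_zero (c := fun _ => 1) hz (by simp)
      (by simpa using h)
  have h2 : ∀ k, w (i + k) = 0 := by
    intro k
    induction k using Nat.strong_induction_on with
    | _ k ih =>
      rcases lt_or_ge k r with hk | hk
      · exact h1 k hk
      · rw [← Nat.sub_add_cancel hk, ← add_assoc, hw.shift, ih _ (by omega), mul_zero]
  have h3 : ∀ m, w (m * r) ≠ 0 := by
    intro m
    induction m with
    | zero => simpa using h0
    | succ m ih =>
      rw [add_mul, one_mul, hw.shift]
      exact mul_ne_zero (fun hz0 => by simp [hz0] at hz) ih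
  have h4 : i ≤ i * r := Nat.le_mul_of_pos_right i hr
  exact h3 i (by rw [← Nat.add_sub_cancel' h4, h2])

/-- Weights whose quotient increases turn the argument forwards. -/
theorem wedge_sum_nonneg (hw : IsTurning r z w) {a b : ℕ → ℝ}
    (hab : ∀ i j, i < j → j < r → a i * b j ≤ a j * b i) :
    0 ≤ wedge (∑ i ∈ Finset.range r, (b i : ℂ) * w i) (∑ j ∈ Finset.range r, (a j : ℂ) * w j) := by
  have h1 : wedge (∑ i ∈ Finset.range r, (b i : ℂ) * w i)
      (∑ j ∈ Finset.range r, (a j : ℂ) * w j) =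
      ∑ i ∈ Finset.range r, ∑ j ∈ Finset.range r, b i * a j * wedge (w i) (w j) := by
    rw [wedge_sum_left]
    refine Finset.sum_congr rfl fun i _ => ?_
    rw [wedge_sum_right]
    refine Finset.sum_congr rfl fun j _ => ?_
    rw [wedge_ofReal_mul_left, wedge_ofReal_mul_right, mul_assoc]
  have h2 : ∑ i ∈ Finset.range r, ∑ j ∈ Finset.range r, b i * a j * wedge (w i) (w j) =
      ∑ i ∈ Finset.range r, ∑ j ∈ Finset.range r, -(b j * a i * wedge (w i) (w j)) := by
    rw [Finset.sum_comm]
    refine Finset.sum_congr rfl fun i _ => Finset.sum_congr rfl fun j _ => ?_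
    rw [wedge_swap (w i) (w j)]; ring
  have h3 : 0 ≤ ∑ i ∈ Finset.range r, ∑ j ∈ Finset.range r,
      (b i * a j * wedge (w i) (w j) + -(b j * a i * wedge (w i) (w j))) := by
    refine Finset.sum_nonneg fun i hi => Finset.sum_nonneg fun j hj => ?_
    rw [Finset.mem_range] at hi hj
    rcases lt_trichotomy i j with hij | rfl | hij
    · nlinarith [mul_nonneg (sub_nonneg.2 (hab i j hij hj))
        (hw.wedge_nonneg' hij.le (by omega))]
    · simp [wedge_self]
    · rw [wedge_swap (w j) (w i)]
      nlinarith [mul_nonneg (sub_nonneg.2 (hab j i hij hi))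
        (hw.wedge_nonneg' hij.le (by omega))]
  simp only [Finset.sum_add_distrib] at h3
  rw [← h2] at h3
  rw [h1]
  linarith

/-- Two consecutive windows may be combined when the weights satisfy
`c i * c (j + r) ≤ c j * c (i + r)`: with `u` and `z * v` the contributions of the two windows,
`v ∧ (u + z * v) = v ∧ u + Im z * |v| ^ 2` is positive unless `v = 0`. -/
theorem mul_eq_zero_of_sum_two_windows_eq_zero (hw : IsTurning r z w) (hz : 0 < z.im) {c : ℕ → ℝ}
    (hc : ∀ k, 0 ≤ c k) (hcr : ∀ i j, i < j → j < r → c i * c (j + r) ≤ c j * c (i + r))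
    (h0 : ∑ k ∈ Finset.range (r + r), (c k : ℂ) * w k = 0) :
    ∀ k < r + r, (c k : ℂ) * w k = 0 := by
  set u := ∑ k ∈ Finset.range r, (c k : ℂ) * w k with hu
  set v := ∑ k ∈ Finset.range r, (c (k + r) : ℂ) * w k with hv
  have h1 : u + z * v = 0 := by
    rw [← h0, Finset.sum_range_add, hv, Finset.mul_sum]
    congr 1
    refine Finset.sum_congr rfl fun k _ => ?_
    rw [add_comm r k, hw.shift]; ring
  have h2 : 0 ≤ wedge v u := hw.wedge_sum_nonneg (b := fun k => c (k + r)) hcr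
  have h3 : wedge v u + z.im * Complex.normSq v = 0 := by
    rw [← wedge_self_mul, ← wedge_add_right, h1]; simp [wedge]
  have h4 : v = 0 := by
    have := mul_nonneg hz.le (Complex.normSq_nonneg v)
    have h5 : z.im * Complex.normSq v = 0 := by linarith
    simpa [hz.ne'] using h5
  have h5 : u = 0 := by simpa [h4] using h1
  intro k hk
  rcases lt_or_ge k r with hkr | hkr
  · exact hw.mul_eq_zero_of_sum_eq_zero hz (fun k _ => hc k) h5 k hkr
  · obtain ⟨m, rfl⟩ := Nat.exists_eq_add_of_le' hkr
    have h6 := hw.mul_eq_zero_of_sum_eq_zero (c := fun k => c (k + r)) hz (fun k _ => hc _) h4 m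
      (by omega)
    rw [hw.shift, mul_left_comm, h6, mul_zero]

end IsTurning

/-! ### Real-rootedness and the upper half-plane -/

/-- Non-real zeros of a real polynomial come in conjugate pairs, so it is enough to exclude those
in the upper half-plane. -/
theorem splits_of_forall_im_pos {p : ℝ[X]} (hp : ∀ z : ℂ, 0 < z.im → aeval z p = 0 → p = 0) :
    p.Splits := by
  by_cases hp0 : p = 0
  · simp [hp0]
  refine Splits.of_splits_map (algebraMap ℝ ℂ) (IsAlgClosed.splits _) fun z hz => ?_
  have hz0 : aeval z p = 0 := by
    rw [mem_roots', IsRoot.def, eval_map_algebraMap] at hz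
    exact hz.2
  rcases lt_trichotomy z.im 0 with h | h | h
  · refine absurd (hp (starRingEnd ℂ z) (by simpa using h) ?_) hp0
    rw [aeval_conj, hz0, map_zero]
  · exact ⟨z.re, Complex.ext (by simp) (by simp [h])⟩
  · exact absurd (hp z h hz0) hp0

/-! ### The Veronese operator as a contraction -/

/-- `U_r^D a` in closed form: since `1 - t ^ r = (1 - t) (1 + t + ⋯ + t ^ (r - 1))`, it keeps every
`r`-th coefficient of `a(t) (1 + t + ⋯ + t ^ (r - 1)) ^ D`. Meant for `r ≥ 1`. -/
noncomputable def veronese (r D : ℕ) (a : ℝ[X]) : ℝ[X] :=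
  contract r (a * (∑ i ∈ Finset.range r, X ^ i) ^ D)

theorem subsequenceNumerator_eq_veronese {r : ℕ} (hr : 1 ≤ r) (D : ℕ) (h : ℝ[X]) :
    subsequenceNumerator r D h = veronese r D h := by
  have hinv : (PowerSeries.invOneSubPow ℝ D).val * (1 - PowerSeries.X) ^ D = 1 := by
    rw [← PowerSeries.invOneSubPow_inv_eq_one_sub_pow ℝ D]
    exact (PowerSeries.invOneSubPow ℝ D).val_inv
  have hgeom : (1 - PowerSeries.X ^ r : PowerSeries ℝ) =
      (1 - PowerSeries.X) * ((∑ i ∈ Finset.range r, X ^ i : ℝ[X]) : PowerSeries ℝ) := by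
    simpa using
      (congrArg (fun f : ℝ[X] => (f : PowerSeries ℝ)) (mul_neg_geom_sum (X : ℝ[X]) r)).symm
  have hclear : ((h * (∑ i ∈ Finset.range r, X ^ i) ^ D : ℝ[X]) : PowerSeries ℝ) =
      ((h : PowerSeries ℝ) * (PowerSeries.invOneSubPow ℝ D).val) *
        (1 - PowerSeries.X ^ r) ^ D := by
    rw [hgeom, mul_pow, mul_assoc, ← mul_assoc _ ((1 - PowerSeries.X) ^ D), hinv, one_mul]
    simp
  apply Polynomial.coe_injective ℝ
  have hspec := congrArg (· * (1 - PowerSeries.X) ^ D) (subsequenceNumerator_spec r hr D h)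
  simp only [mul_assoc, hinv, mul_one] at hspec
  rw [← hspec]
  unfold numeratorSequence
  rw [← mk_subsequence_mul_one_sub_pow r hr, ← hclear]
  ext n
  rw [PowerSeries.coeff_mk, Polynomial.coeff_coe, Polynomial.coeff_coe, veronese,
    coeff_contract (by omega), mul_comm n r]

section veronese

variable {r : ℕ}

theorem veronese_C_mul (hr : r ≠ 0) (D : ℕ) (c : ℝ) (a : ℝ[X]) :
    veronese r D (C c * a) = C c * veronese r D a := by
  ext n; simp [veronese, coeff_contract hr, mul_assoc]

theorem veronese_sub (hr : r ≠ 0) (D : ℕ) (a b : ℝ[X]) :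
    veronese r D (a - b) = veronese r D a - veronese r D b := by
  ext n; simp [veronese, coeff_contract hr, sub_mul]

theorem veronese_sum (hr : r ≠ 0) (D : ℕ) {ι : Type*} (s : Finset ι) (f : ι → ℝ[X]) :
    veronese r D (∑ i ∈ s, f i) = ∑ i ∈ s, veronese r D (f i) := by
  ext n; simp [veronese, coeff_contract hr, Finset.sum_mul, finsetSum_coeff]

theorem veronese_eq_sum (hr : r ≠ 0) (D : ℕ) {a : ℝ[X]} {N : ℕ} (ha : a.natDegree < N) :
    veronese r D a = ∑ k ∈ Finset.range N, C (a.coeff k) * veronese r D (X ^ k) := by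
  conv_lhs => rw [a.as_sum_range_C_mul_X_pow' ha, veronese_sum hr]
  simp only [veronese_C_mul hr]

theorem veronese_mul_X_pow (hr : r ≠ 0) (D : ℕ) (a : ℝ[X]) :
    veronese r D (a * X ^ r) = veronese r D a * X := by
  rw [veronese, mul_right_comm, ← expand_X, contract_mul_expand hr]; rfl

theorem veronese_succ (D : ℕ) (a : ℝ[X]) :
    veronese r (D + 1) a = veronese r D (a * ∑ i ∈ Finset.range r, X ^ i) := by
  rw [veronese, veronese, pow_succ', mul_assoc]

/-- Cancelling a factor `1 - t` lowers the exponent of the denominator by one. -/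
theorem veronese_succ_mul_one_sub (hr : r ≠ 0) (D : ℕ) (a : ℝ[X]) :
    veronese r (D + 1) ((1 - X) * a) = (1 - X) * veronese r D a := by
  rw [veronese_succ, mul_right_comm, mul_neg_geom_sum, sub_mul, one_mul, mul_comm (X ^ r),
    veronese_sub hr, veronese_mul_X_pow hr]
  ring

theorem coeff_mul_nonneg {a b : ℝ[X]} (ha : ∀ i, 0 ≤ a.coeff i) (hb : ∀ i, 0 ≤ b.coeff i) (n : ℕ) :
    0 ≤ (a * b).coeff n := by
  rw [coeff_mul]
  exact Finset.sum_nonneg fun x _ => mul_nonneg (ha _) (hb _)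

theorem coeff_veronese_nonneg (hr : r ≠ 0) (D : ℕ) {a : ℝ[X]} (ha : ∀ i, 0 ≤ a.coeff i) (n : ℕ) :
    0 ≤ (veronese r D a).coeff n := by
  rw [veronese, coeff_contract hr]
  refine coeff_mul_nonneg ha (fun i => ?_) _
  induction D generalizing i with
  | zero => rw [pow_zero, coeff_one]; split_ifs <;> simp
  | succ D ih =>
    rw [pow_succ]
    refine coeff_mul_nonneg ih (fun j => ?_) i
    simp only [finsetSum_coeff, coeff_X_pow]
    exact Finset.sum_nonneg fun k _ => by split_ifs <;> simp

theorem natDegree_geom_sum_le (r : ℕ) :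
    (∑ i ∈ Finset.range r, X ^ i : ℝ[X]).natDegree ≤ r - 1 := by
  refine natDegree_sum_le_of_forall_le _ _ fun i hi => ?_
  rw [Finset.mem_range] at hi
  rw [natDegree_X_pow]
  omega

theorem reflect_geom_sum (r : ℕ) :
    (∑ i ∈ Finset.range r, X ^ i : ℝ[X]).reflect (r - 1) = ∑ i ∈ Finset.range r, X ^ i := by
  ext n
  rw [coeff_reflect]
  simp only [finsetSum_coeff, coeff_X_pow, Finset.sum_ite_eq, Finset.mem_range]
  rcases le_or_gt n (r - 1) with h | h
  · rw [revAt_le h]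
    congr 1
    simp only [eq_iff_iff]
    omega
  · rw [revAt_eq_self_of_lt h]

theorem reflect_geom_sum_pow (r D : ℕ) :
    ((∑ i ∈ Finset.range r, X ^ i : ℝ[X]) ^ D).natDegree ≤ D * (r - 1) ∧
    ((∑ i ∈ Finset.range r, X ^ i : ℝ[X]) ^ D).reflect (D * (r - 1)) =
      (∑ i ∈ Finset.range r, X ^ i) ^ D := by
  induction D with
  | zero => simp
  | succ D ih =>
    constructor
    · exact natDegree_pow_le_of_le _ (natDegree_geom_sum_le r)
    · rw [pow_succ, add_mul, one_mul, reflect_mul _ _ ih.1 (natDegree_geom_sum_le r), ih.2,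
        reflect_geom_sum]

theorem natDegree_veronese_le (hr : r ≠ 0) {D N M : ℕ} {a : ℝ[X]} (hN : a.natDegree ≤ N)
    (hM : N + D * (r - 1) = M * r) : (veronese r D a).natDegree ≤ M := by
  rw [natDegree_le_iff_coeff_eq_zero]
  intro n hn
  rw [veronese, coeff_contract hr]
  refine coeff_eq_zero_of_natDegree_lt ?_
  refine (natDegree_mul_le_of_le hN (reflect_geom_sum_pow r D).1).trans_lt ?_
  rw [hM]
  exact Nat.mul_lt_mul_of_pos_right hn (Nat.pos_of_ne_zero hr)

/-- The Veronese operator preserves palindromicity. -/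
theorem reflect_veronese (hr : r ≠ 0) {D N M : ℕ} {a : ℝ[X]} (hN : a.natDegree ≤ N)
    (ha : a.reflect N = a) (hM : N + D * (r - 1) = M * r) :
    (veronese r D a).reflect M = veronese r D a := by
  ext n
  rw [coeff_reflect, veronese, coeff_contract hr, coeff_contract hr]
  rcases le_or_gt n M with h | h
  · conv_rhs => rw [← ha, ← (reflect_geom_sum_pow r D).2,
      ← reflect_mul _ _ hN (reflect_geom_sum_pow r D).1, coeff_reflect, hM,
      revAt_le (Nat.mul_le_mul_right r h)]
    rw [revAt_le h, Nat.sub_mul]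
  · rw [revAt_eq_self_of_lt h]

/-! ### Real-rootedness of Veronese sections -/

theorem aeval_veronese_X_pow_succ (hr : r ≠ 0) (D j : ℕ) (z : ℂ) :
    aeval z (veronese r (D + 1) (X ^ j)) =
      ∑ k ∈ Finset.range r, aeval z (veronese r D (X ^ (j + k))) := by
  rw [veronese_succ, Finset.mul_sum, veronese_sum hr, map_sum]
  simp only [pow_add]

theorem aeval_veronese_zero_X_pow {z : ℂ} :
    aeval z (veronese r 0 (X ^ 0)) = 1 := by
  have : veronese r 0 (X ^ 0) = 1 := by simpa [veronese] using contract_C (p := r) (1 : ℝ)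
  rw [this, map_one]

theorem isTurning_veronese (hr : 1 ≤ r) (D : ℕ) {z : ℂ} (hz : 0 < z.im) :
    IsTurning r z (fun j => aeval z (veronese r D (X ^ j))) := by
  have hr0 : r ≠ 0 := by omega
  have hshift (D j : ℕ) :
      aeval z (veronese r D (X ^ (j + r))) = z * aeval z (veronese r D (X ^ j)) := by
    rw [pow_add, veronese_mul_X_pow hr0, map_mul, aeval_X, mul_comm]
  induction D with
  | zero =>
    refine ⟨hshift 0, fun i k hk => ?_⟩
    have hne (j : ℕ) (hj : ¬ r ∣ j) : aeval z (veronese r 0 (X ^ j)) = 0 := by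
      have : veronese r 0 (X ^ j) = 0 := by
        ext n
        rw [veronese, pow_zero, mul_one, coeff_contract hr0, coeff_X_pow, if_neg, coeff_zero]
        rintro rfl
        exact hj (dvd_mul_left r n)
      rw [this, map_zero]
    -- Only multiples of `r` contribute, and two of them at distance at most `r` are equal or
    -- consecutive.
    by_cases hi : r ∣ i
    · rcases Nat.eq_zero_or_pos k with rfl | hk0
      · rw [add_zero, wedge_self]
      · rcases hk.eq_or_lt with rfl | hkr
        · simp only [hshift]
          rw [wedge_self_mul]
          exact mul_nonneg hz.le (Complex.normSq_nonneg _)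
        · rw [hne (i + k) ?_]
          · simp [wedge]
          · rw [Nat.dvd_add_right hi]
            exact Nat.not_dvd_of_pos_of_lt hk0 hkr
    · simp only [hne i hi]
      rw [wedge_zero_left]
  | succ D ih =>
    simpa only [aeval_veronese_X_pow_succ hr0] using ih.window_sum hz

theorem aeval_veronese_X_pow_ne_zero (hr : 1 ≤ r) {D : ℕ} (hD : D ≠ 0) {z : ℂ} (hz : 0 < z.im)
    (j : ℕ) : aeval z (veronese r D (X ^ j)) ≠ 0 := by
  have hr0 : r ≠ 0 := by omega
  obtain ⟨D, rfl⟩ := Nat.exists_eq_succ_of_ne_zero hD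
  have h0 (D : ℕ) : aeval z (veronese r D (X ^ 0)) ≠ 0 := by
    induction D with
    | zero => rw [aeval_veronese_zero_X_pow]; exact one_ne_zero
    | succ D ih =>
      rw [aeval_veronese_X_pow_succ hr0]
      exact (isTurning_veronese hr D hz).window_sum_ne_zero hz hr ih 0
  rw [aeval_veronese_X_pow_succ hr0]
  exact (isTurning_veronese hr D hz).window_sum_ne_zero hz hr (h0 D) j

theorem splits_veronese (hr : 1 ≤ r) {D : ℕ} (hD : D ≠ 0) {a : ℝ[X]} (hdeg : a.natDegree < r + r)
    (ha : ∀ i, 0 ≤ a.coeff i)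
    (hmono : ∀ i j, i < j → j < r → a.coeff i * a.coeff (j + r) ≤ a.coeff j * a.coeff (i + r)) :
    (veronese r D a).Splits := by
  refine splits_of_forall_im_pos fun z hz h0 => ?_
  have hr0 : r ≠ 0 := by omega
  rw [veronese_eq_sum hr0 D hdeg] at h0 ⊢
  simp only [map_sum, map_mul, aeval_C, Complex.coe_algebraMap] at h0
  refine Finset.sum_eq_zero fun k hk => ?_
  have h1 := (isTurning_veronese hr D hz).mul_eq_zero_of_sum_two_windows_eq_zero hz ha hmono h0 k
    (Finset.mem_range.1 hk)
  have h2 : a.coeff k = 0 := by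
    simpa [aeval_veronese_X_pow_ne_zero hr hD hz k] using h1
  rw [h2, C_0, zero_mul]

end veronese

/-! ### Palindromic quotients by `1 - t` -/

theorem eval_one_reflect {N : ℕ} {g : ℝ[X]} (hN : g.natDegree ≤ N) :
    (g.reflect N).eval 1 = g.eval 1 := by
  let : Invertible (1 : ℝ) := invertibleOne
  simpa [eval₂_id] using eval₂_reflect_mul_pow (RingHom.id ℝ) 1 N g hN

theorem exists_one_sub_X_mul_eq {N : ℕ} {g : ℝ[X]} (hN : g.natDegree ≤ N + 1)
    (hg : g.reflect (N + 1) = -g) :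
    ∃ a : ℝ[X], (1 - X) * a = g ∧ a.natDegree ≤ N ∧ a.reflect N = a ∧
      ∀ n, a.coeff n = ∑ k ∈ Finset.range (n + 1), g.coeff k := by
  have hroot : g.IsRoot 1 := by
    have := eval_one_reflect hN
    rw [hg, eval_neg] at this
    rw [IsRoot.def]
    linarith
  obtain ⟨b, hb⟩ := dvd_iff_isRoot.2 hroot
  have hlin : (1 - X : ℝ[X]).natDegree = 1 := by
    rw [← neg_sub, natDegree_neg, ← C_1, natDegree_X_sub_C]
  have hlin0 : (1 - X : ℝ[X]) ≠ 0 := fun h => by simp [h] at hlin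
  have ha : (1 - X) * -b = g := by rw [hb, C_1]; ring
  have hdeg : (-b).natDegree ≤ N := by
    by_cases hb0 : -b = 0
    · simp [hb0]
    · rw [← ha, natDegree_mul hlin0 hb0, hlin] at hN
      omega
  refine ⟨-b, ha, hdeg, ?_, fun n => ?_⟩
  · have h1 : (1 - X : ℝ[X]).reflect 1 = -(1 - X) := by
      rw [sub_eq_add_neg, reflect_add, reflect_neg, reflect_one_X, reflect_one]
      ring
    have h2 := hg
    rw [← ha, add_comm N 1, reflect_mul _ _ hlin.le hdeg, h1, neg_mul, neg_inj] at h2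
    exact mul_left_cancel₀ hlin0 h2
  · have hcoeff (n : ℕ) : g.coeff (n + 1) = (-b).coeff (n + 1) - (-b).coeff n := by
      rw [← ha, sub_mul, one_mul, coeff_sub, coeff_X_mul]
    have hzero : g.coeff 0 = (-b).coeff 0 := by
      rw [← ha, sub_mul, one_mul, coeff_sub, coeff_X_mul_zero, sub_zero]
    induction n with
    | zero => rw [zero_add, Finset.sum_range_one, hzero]
    | succ n ih => rw [Finset.sum_range_succ, ← ih, hcoeff]; ring

theorem coeff_eq_of_reflect_eq {N : ℕ} {a : ℝ[X]} (ha : a.reflect N = a) {n : ℕ} (hn : n ≤ N) :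
    a.coeff n = a.coeff (N - n) := by
  conv_lhs => rw [← ha]
  rw [coeff_reflect, revAt_le hn]

theorem le_of_forall_le_succ_below {c : ℕ → ℝ} {L : ℕ} (hc : ∀ n, n + 1 < L → c n ≤ c (n + 1))
    {i j : ℕ} (hij : i ≤ j) (hj : j < L) : c i ≤ c j := by
  induction j, hij using Nat.le_induction with
  | base => exact le_rfl
  | succ j _ ih => exact (ih (by omega)).trans (hc j hj)

/-! ### The two parts of the decomposition -/

section parts

variable {d s r : ℕ} {h : ℝ[X]}

theorem coeff_reflect_nonneg (hnonneg : ∀ i, 0 ≤ h.coeff i) (N n : ℕ) :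
    0 ≤ (h.reflect N).coeff n := by
  rw [coeff_reflect]; exact hnonneg _

theorem natDegree_reflect_le_of_le {N : ℕ} (hN : h.natDegree ≤ N) :
    (h.reflect N).natDegree ≤ N :=
  natDegree_reflect_le.trans (max_le le_rfl hN)

theorem coeff_reflect_eq_zero (hsd : s ≤ d) (hdeg : h.natDegree = s) {n : ℕ}
    (hn : n < d + 1 - s) : (h.reflect (d + 1)).coeff n = 0 := by
  rw [coeff_reflect, revAt_le (by omega)]
  exact coeff_eq_zero_of_natDegree_lt (by omega)

/-- The numerator `a`, with respect to the denominator `(1 - t) ^ d`, whose image under `U_r` is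
the palindromic part `p`. Its coefficients are the differences in condition (H); below
`d + 1 - s` they increase. -/
theorem exists_left_numerator (hsd : s ≤ d) (hdeg : h.natDegree = s)
    (hnonneg : ∀ i, 0 ≤ h.coeff i)
    (hH : ∀ i ≤ d, ∑ j ∈ Finset.range i, h.coeff (d - j) ≤
      ∑ j ∈ Finset.range (i + 1), h.coeff j)
    (hr : max s (d + 1 - s) ≤ r) :
    ∃ a : ℝ[X], (1 - X) * a = h - h.reflect (d + 1) ∧ a.natDegree ≤ d ∧ a.reflect d = a ∧
      (∀ i, 0 ≤ a.coeff i) ∧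
      ∀ i j, i < j → j < r → a.coeff i * a.coeff (j + r) ≤ a.coeff j * a.coeff (i + r) := by
  rw [max_le_iff] at hr
  have hdeg' : h.natDegree ≤ d + 1 := by omega
  obtain ⟨a, ha, hdega, hrefl, hcoeff⟩ :=
    exists_one_sub_X_mul_eq (N := d) (g := h - h.reflect (d + 1))
      ((natDegree_sub_le _ _).trans (max_le hdeg' (natDegree_reflect_le_of_le hdeg')))
      (by rw [sub_eq_add_neg, reflect_add, reflect_neg, reflect_reflect]; ring)
  have hpos : ∀ i, 0 ≤ a.coeff i := by
    intro i
    rcases le_or_gt i d with hi | hi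
    · rw [hcoeff]
      simp only [coeff_sub]
      rw [Finset.sum_sub_distrib, sub_nonneg, Finset.sum_range_succ',
        coeff_reflect_eq_zero hsd hdeg (by omega), add_zero]
      refine le_trans (le_of_eq ?_) (hH i hi)
      refine Finset.sum_congr rfl fun k hk => ?_
      rw [Finset.mem_range] at hk
      rw [coeff_reflect, revAt_le (by omega), Nat.add_sub_add_right]
    · rw [coeff_eq_zero_of_natDegree_lt (by omega)]
  have hmono : ∀ n, n + 1 < d + 1 - s → a.coeff n ≤ a.coeff (n + 1) := by
    intro n hn
    rw [hcoeff (n + 1), Finset.sum_range_succ, ← hcoeff, coeff_sub,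
      coeff_reflect_eq_zero hsd hdeg hn]
    linarith [hnonneg (n + 1)]
  refine ⟨a, ha, hdega, hrefl, hpos, fun i j hij hj => ?_⟩
  rcases le_or_gt (j + r) d with hjr | hjr
  · -- Here `i`, `j` and the mirror images of `i + r` and `j + r` all lie below `d + 1 - s`.
    rw [coeff_eq_of_reflect_eq hrefl hjr, coeff_eq_of_reflect_eq hrefl (n := i + r) (by omega)]
    exact mul_le_mul (le_of_forall_le_succ_below hmono hij.le (by omega))
      (le_of_forall_le_succ_below hmono (by omega) (by omega)) (hpos _) (hpos _)
  · rw [coeff_eq_zero_of_natDegree_lt (n := j + r) (by omega), mul_zero]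
    exact mul_nonneg (hpos _) (hpos _)

/-- The numerator `e`, with respect to the denominator `(1 - t) ^ d`, whose image under `U_r` is
`t * q`. Its coefficients below `r` are partial sums of those of `t ^ (d + 1) h(1/t)`,
hence increase, and the middle ones are nonnegative by condition (S). -/
theorem exists_right_numerator (hsd : s ≤ d) (hdeg : h.natDegree = s)
    (hnonneg : ∀ i, 0 ≤ h.coeff i)
    (hS : ∀ i ≤ s, ∑ j ∈ Finset.range (i + 1), h.coeff j ≤
      ∑ j ∈ Finset.range (i + 1), h.coeff (s - j))
    (hr : max s (d + 1 - s) ≤ r) :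
    ∃ e : ℝ[X], (1 - X) * e = h.reflect (d + 1) - h * X ^ r ∧ e.natDegree ≤ d + r ∧
      e.reflect (d + r) = e ∧ e.coeff 0 = 0 ∧ (∀ i, 0 ≤ e.coeff i) ∧ e.natDegree < r + r ∧
      ∀ i j, i < j → j < r → e.coeff i * e.coeff (j + r) ≤ e.coeff j * e.coeff (i + r) := by
  rw [max_le_iff] at hr
  have hdeg' : h.natDegree ≤ d + 1 := by omega
  have hdeg'' := natDegree_reflect_le_of_le hdeg'
  have hdegX : (h * X ^ r).natDegree ≤ d + r + 1 :=
    (natDegree_mul_le_of_le hdeg' (natDegree_X_pow_le r)).trans (by omega)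
  have hflip : (h.reflect (d + 1)).reflect (d + r + 1) = h * X ^ r := by
    conv_lhs => rw [← mul_one (h.reflect (d + 1)), add_right_comm,
      reflect_mul _ 1 hdeg'' (natDegree_one.le.trans (Nat.zero_le r)), reflect_reflect, reflect_one]
  obtain ⟨e, he, hdege, hrefl, hcoeff⟩ :=
    exists_one_sub_X_mul_eq (N := d + r) (g := h.reflect (d + 1) - h * X ^ r)
      ((natDegree_sub_le _ _).trans (max_le (hdeg''.trans (by omega)) hdegX))
      (by rw [sub_eq_add_neg, reflect_add, reflect_neg, ← hflip, reflect_reflect, hflip]; ring)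
  have hlow : ∀ n < r, e.coeff n = ∑ k ∈ Finset.range (n + 1), (h.reflect (d + 1)).coeff k := by
    intro n hn
    rw [hcoeff]
    refine Finset.sum_congr rfl fun k hk => ?_
    rw [Finset.mem_range] at hk
    rw [coeff_sub, coeff_mul_X_pow', if_neg (by omega), sub_zero]
  have hzero : ∀ n < d + 1 - s, e.coeff n = 0 := by
    intro n hn
    rw [hlow n (by omega)]
    refine Finset.sum_eq_zero fun k hk => coeff_reflect_eq_zero hsd hdeg ?_
    rw [Finset.mem_range] at hk
    omega
  have hposlow : ∀ n < r, 0 ≤ e.coeff n := by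
    intro n hn
    rw [hlow n hn]
    exact Finset.sum_nonneg fun k _ => coeff_reflect_nonneg hnonneg _ _
  have hpos : ∀ i, 0 ≤ e.coeff i := by
    intro i
    rcases lt_or_ge i r with hi | hi
    · exact hposlow i hi
    rcases le_or_gt (d + r + 1) i with hi' | hi'
    · rw [coeff_eq_zero_of_natDegree_lt (by omega)]
    rcases lt_or_ge d i with hid | hid
    · rw [coeff_eq_of_reflect_eq hrefl (by omega)]
      exact hposlow _ (by omega)
    · rw [hcoeff]
      simp only [coeff_sub]
      rw [Finset.sum_sub_distrib, sub_nonneg]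
      have h1 : ∑ k ∈ Finset.range (i + 1), (h * X ^ r).coeff k =
          ∑ k ∈ Finset.range (i - r + 1), h.coeff k := by
        rw [show i + 1 = r + (i - r + 1) by omega, Finset.sum_range_add,
          Finset.sum_eq_zero, zero_add]
        · exact Finset.sum_congr rfl fun k _ => by rw [add_comm, coeff_mul_X_pow]
        · intro k hk
          rw [Finset.mem_range] at hk
          rw [coeff_mul_X_pow', if_neg (by omega)]
      have h2 : ∑ k ∈ Finset.range (i + 1), (h.reflect (d + 1)).coeff k =
          ∑ k ∈ Finset.range (i + 1 - (d + 1 - s)), h.coeff (s - k) := by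
        rw [show Finset.range (i + 1) =
            Finset.range ((d + 1 - s) + (i + 1 - (d + 1 - s))) by congr 1; omega,
          Finset.sum_range_add, Finset.sum_eq_zero, zero_add]
        · refine Finset.sum_congr rfl fun k hk => ?_
          rw [Finset.mem_range] at hk
          rw [coeff_reflect, revAt_le (by omega)]
          congr 1
          omega
        · intro k hk
          rw [Finset.mem_range] at hk
          exact coeff_reflect_eq_zero hsd hdeg hk
      rw [h1, h2]
      refine (hS (i - r) (by omega)).trans ?_
      exact Finset.sum_le_sum_of_subset_of_nonneg
        (Finset.range_subset_range.2 (by omega)) fun k _ _ => hnonneg _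
  have hmono : ∀ n, n + 1 < r → e.coeff n ≤ e.coeff (n + 1) := by
    intro n hn
    rw [hlow _ hn, Finset.sum_range_succ, ← hlow n (by omega)]
    linarith [coeff_reflect_nonneg hnonneg (d + 1) (n + 1)]
  have hhigh : ∀ n, s + r ≤ n → e.coeff n = 0 := by
    intro n hn
    rcases le_or_gt n (d + r) with hn' | hn'
    · rw [coeff_eq_of_reflect_eq hrefl hn', hzero _ (by omega)]
    · exact coeff_eq_zero_of_natDegree_lt (by omega)
  refine ⟨e, he, hdege, hrefl, hzero 0 (by omega), hpos, ?_, fun i j hij hj => ?_⟩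
  · exact lt_of_le_of_lt (natDegree_le_iff_coeff_eq_zero.2 fun n (hn : r + r - 1 < n) =>
      hhigh n (by omega)) (by omega)
  · rcases lt_or_ge i (d + 1 - s) with hi | hi
    · rw [hzero i hi, zero_mul]
      exact mul_nonneg (hpos _) (hpos _)
    rcases lt_or_ge j s with hjs | hjs
    · rw [coeff_eq_of_reflect_eq hrefl (n := j + r) (by omega),
        coeff_eq_of_reflect_eq hrefl (n := i + r) (by omega)]
      exact mul_le_mul (le_of_forall_le_succ_below hmono hij.le hj)
        (le_of_forall_le_succ_below hmono (by omega) (by omega)) (hpos _) (hpos _)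
    · rw [hhigh (j + r) (by omega), mul_zero]
      exact mul_nonneg (hpos _) (hpos _)

end parts

theorem theorem1 (d s r : ℕ) (hsd : s ≤ d) (h : ℝ[X]) (hdeg : h.natDegree = s)
    (hnonneg : ∀ i, 0 ≤ h.coeff i)
    (hH : ∀ i ≤ d, ∑ j ∈ Finset.range i, h.coeff (d - j) ≤
      ∑ j ∈ Finset.range (i + 1), h.coeff j)
    (hS : ∀ i ≤ s, ∑ j ∈ Finset.range (i + 1), h.coeff j ≤
      ∑ j ∈ Finset.range (i + 1), h.coeff (s - j))
    (hr : max s (d + 1 - s) ≤ r) :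
    ∃ p q : ℝ[X], IsSymmetricDecomposition d (subsequenceNumerator r (d + 1) h) p q ∧
      (∀ i, 0 ≤ p.coeff i) ∧ (∀ i, 0 ≤ q.coeff i) ∧ p.Splits ∧ q.Splits := by
  obtain ⟨a, ha, hdega, hrefla, hposa, hmonoa⟩ := exists_left_numerator hsd hdeg hnonneg hH hr
  obtain ⟨e, he, hdege, hrefle, he0, hpose, hdege', hmonoe⟩ :=
    exists_right_numerator hsd hdeg hnonneg hS hr
  rw [max_le_iff] at hr
  have hr1 : 1 ≤ r := by omega
  have hr0 : r ≠ 0 := by omega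
  have hdega' : a.natDegree < r + r := by omega
  have hMa : d + d * (r - 1) = d * r := by
    obtain ⟨r, rfl⟩ := Nat.exists_eq_add_of_le' hr1
    rw [Nat.add_sub_cancel]; ring
  have hMe : d + r + d * (r - 1) = (d + 1) * r := by rw [add_mul, one_mul, ← hMa]; ring
  obtain ⟨q, hq⟩ : X ∣ veronese r d e := by
    rw [X_dvd_iff, veronese, coeff_contract hr0, zero_mul, mul_coeff_zero, he0, zero_mul]
  have hcoeff (n : ℕ) : q.coeff n = (veronese r d e).coeff (n + 1) := by rw [hq, coeff_X_mul]
  have hreflq := reflect_veronese hr0 hdege hrefle hMe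
  have hdegq : ∀ m, d ≤ m → q.coeff m = 0 := by
    intro m hm
    rw [hcoeff]
    rcases hm.eq_or_lt with rfl | hm
    · rw [coeff_eq_of_reflect_eq hreflq le_rfl, Nat.sub_self, hq, coeff_X_mul_zero]
    · exact coeff_eq_zero_of_natDegree_lt
        ((natDegree_veronese_le hr0 hdege hMe).trans_lt (by omega))
  have hdegp := natDegree_veronese_le hr0 hdega hMa
  refine ⟨veronese r d a, q, ⟨?_, ?_, ?_, ?_, ?_⟩, coeff_veronese_nonneg hr0 d hposa, fun i => ?_,
    ?_, ?_⟩
  · have hlin0 : (1 - X : ℝ[X]) ≠ 0 := fun h0 => by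
      simpa using congrArg (coeff · 0) h0
    apply mul_left_cancel₀ hlin0
    rw [subsequenceNumerator_eq_veronese hr1, ← hq, mul_add,
      ← veronese_succ_mul_one_sub hr0 d a, ← veronese_succ_mul_one_sub hr0 d e, ha, he,
      veronese_sub hr0, veronese_sub hr0, veronese_mul_X_pow hr0]
    ring
  · exact degree_le_of_natDegree_le hdegp
  · exact reflect_veronese hr0 hdega hrefla hMa
  · rw [degree_lt_iff_coeff_zero]
    exact hdegq
  · ext n
    rw [coeff_reflect]
    rcases le_or_gt n (d - 1) with hn | hn
    · rw [revAt_le hn]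
      rcases Nat.eq_zero_or_pos d with rfl | hd
      · rw [hdegq _ (Nat.zero_le _), hdegq _ (Nat.zero_le _)]
      · rw [hcoeff, hcoeff, coeff_eq_of_reflect_eq hreflq (n := n + 1) (by omega)]
        congr 1
        omega
    · rw [revAt_eq_self_of_lt hn]
  · rw [hcoeff]
    exact coeff_veronese_nonneg hr0 d hpose _
  · rcases Nat.eq_zero_or_pos d with rfl | hd
    · exact Splits.of_natDegree_eq_zero (Nat.le_zero.1 hdegp)
    · exact splits_veronese hr1 hd.ne' hdega' hposa hmonoa
  · by_cases hq0 : q = 0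
    · rw [hq0]; exact Splits.zero
    · have hd : d ≠ 0 := by
        rintro rfl
        exact hq0 (ext fun n => by rw [hdegq n (Nat.zero_le n), coeff_zero])
      refine (splits_veronese hr1 hd hdege' hpose hmonoe).of_dvd ?_ ⟨X, by rw [hq, mul_comm]⟩
      rw [hq]
      exact mul_ne_zero X_ne_zero hq0
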